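/- Let $n \ge 4$. Let $e_1,\dots,e_n$ be the unit vectors of $\mathbb{Z}_2^n$, let $$S=\{e_1,\dots,e_n\}\cup\{e_k+e_{k+1}+\cdots+e_n : 1\le k\le n-1\}$$ (so $|S|=2n-1$), and let the augmented cube $AQ_n=\mathrm{Cay}(\mathbb{Z}_2^n,S)$ be the graph on $\mathbb{Z}_2^n$ in which $x$ and $y$ are adjacent if and only if $x+y\in S$. Let $G=\mathrm{Aut}(AQ_n)$ be its automorphism group, let $G_e$ be the stabilizer in $G$ of the zero vector $e$, and let $D_8$ be the dihedral group of order $8$. Then: 1. $G_e\cong D_8$. 2. $AQ_n$ is a normal Cayley graph, that is, $G=R(\mathbb{Z}_2^n)\,\mathrm{Aut}(\mathbb{Z}_2^n,S)$, where $R(\mathbb{Z}_2^n)$ is the group of all translations $\rho_z:x\mapsto x+z$ and $\mathrm{Aut}(\mathbb{Z}_2^n,S)$ is the group of automorphisms of the group $\mathbb{Z}_2^n$ that map $S$ onto itself. 3. $G\cong\mathbb{Z}_2^n\rtimes D_8$. More precisely, there are an action of $D_8$ on $\mathbb{Z}_2^n$ by group automorphisms and an isomorphism from the corresponding semidirect product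 $\mathbb{Z}_2^n\rtimes D_8$ onto $G$ that sends each $z\in\mathbb{Z}_2^n$ to the translation $\rho_z$ and maps the factor $D_8$ onto $G_e$. -/

import Mathlib

open scoped Pointwise

/-- The group `ℤ₂ⁿ`; the coordinate written `i`-th from the left (`i = 1, …, n`) is the one with
index `i - 1`. -/
abbrev Z2 (n : ℕ) : Type := Fin n → ZMod 2

/-- The vector `0⋯01⋯1` whose entries are `1` exactly from the coordinate `k` onwards. -/
def onesFrom {n : ℕ} (k : Fin n) : Z2 n := fun j => if k ≤ j then 1 else 0

/-- The `2n - 1` generators: the unit vectors, and the vectors `0⋯01⋯1` with at least two final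
ones, i.e. `0⋯011, 0⋯0111, …, 11⋯1`. -/
def augGens (n : ℕ) : Set (Z2 n) :=
  {v | ∃ i : Fin n, v = Pi.single i 1} ∪ {v | ∃ k : Fin n, (k : ℕ) + 1 < n ∧ v = onesFrom k}

/-- The augmented cube graph: the Cayley graph of `ℤ₂ⁿ` with respect to `augGens n`. -/
def AQ (n : ℕ) : SimpleGraph (Z2 n) := SimpleGraph.addCayley (augGens n)

/-- The regular representation `R(H)` of an abelian group: all translations `x ↦ x + z`. -/
def translations (H : Type*) [AddCommGroup H] : Set (Equiv.Perm H) :=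
  {σ | ∃ z : H, ∀ x, σ x = x + z}

/-- `Aut(H, S)`: the group automorphisms of `H` that fix `S` setwise, as permutations of `H`. -/
def autFixing {H : Type*} [AddCommGroup H] (S : Set H) : Set (Equiv.Perm H) :=
  {σ | ∃ φ : H ≃+ H, φ '' S = S ∧ ∀ x, σ x = φ x}

/-- The Cayley graph of the abelian group `H` with respect to `S` is normal: its full automorphism
group, as a set of permutations of `H`, is the product `R(H) Aut(H, S)`. -/
def IsNormalCayley {H : Type*} [AddCommGroup H] (S : Set H) : Prop :=
  Set.range (fun g : SimpleGraph.addCayley S ≃g SimpleGraph.addCayley S => g.toEquiv) =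
    translations H * autFixing S

/-! Write `s_m` for `stripGen n m` and `L = 2 * (n - 1)`. In the order `s_0, …, s_L` the generators
satisfy `s_{2k} + s_{2k+2} = s_{2k+1}`, and two generators sum to a generator exactly when they lie
in a common such triple (`stripGen_add_mem_iff`). Hence the neighbourhood of every vertex of the
augmented cube induces a chain of triangles, consecutive ones sharing an even vertex. Such a chain
has only eight symmetries: an end may be exchanged with its twin in the same triangle, at either
side, and the chain may be reversed.

All eight are induced by linear maps (`firstSwap`, `stripReversal`), which yields a faithful action
of the dihedral group fixing 0. Conversely, an automorphism that fixes 0 maps `s_0` to one of the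
four ends of the chain (`zero_mem_ends`), so a dihedral element brings it back; then `s_L` is fixed
or sent to `s_{L-1}` (`last_eq_or`), and a reflection corrects that.

It remains that an automorphism fixing 0, `s_0` and `s_L` is trivial. It fixes all neighbours of 0,
and this propagates: if a vertex and its neighbours are fixed, so are the neighbours of those
neighbours (`fixes_second_neighbors`, where `4 ≤ n` enters). Connectedness then gives
`IsAQEmbedding.eq_self`. Thus the stabilizer of 0 is dihedral and linear, and composing with
translations gives normality and the semidirect product. -/

/-! ### Rigidity of a strip of triangles -/

/-- Adjacency in a strip of triangles: the triangles are `{2k, 2k + 1, 2k + 2}`. -/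
def StripAdj (i j : ℕ) : Prop :=
  i + 1 = j ∨ j + 1 = i ∨ (i % 2 = 0 ∧ (i + 2 = j ∨ j + 2 = i))

/-- `α` restricts to an injective endomorphism of the strip with vertices `0, …, L`. -/
structure IsStripEmbedding (L : ℕ) (α : ℕ → ℕ) : Prop where
  le : ∀ i ≤ L, α i ≤ L
  inj : ∀ i ≤ L, ∀ j ≤ L, α i = α j → i = j
  adj : ∀ i ≤ L, ∀ j ≤ L, StripAdj i j → StripAdj (α i) (α j)

namespace IsStripEmbedding

variable {n : ℕ} {α : ℕ → ℕ}

/-- The only neighbours of `2 * k` outside the part already fixed are these two, and injectivity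
keeps their images out of that part. Here `n` is the number of triangles; the augmented cube uses `n
- 1`. -/
theorem maps_next_pair (h : IsStripEmbedding (2 * n) α) {k : ℕ} (hk : k < n)
    (hfix : ∀ i ≤ 2 * k, α i = i) :
    (α (2 * k + 1) = 2 * k + 1 ∧ α (2 * k + 2) = 2 * k + 2) ∨
      (α (2 * k + 1) = 2 * k + 2 ∧ α (2 * k + 2) = 2 * k + 1) := by
  have a1 := h.adj (2 * k) (by omega) (2 * k + 1) (by omega) (by unfold StripAdj; omega)
  have a2 := h.adj (2 * k) (by omega) (2 * k + 2) (by omega) (by unfold StripAdj; omega)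
  have i0 := h.inj (2 * k + 1) (by omega) (2 * k + 2) (by omega)
  have i1 : ∀ i ≤ 2 * k, α (2 * k + 1) ≠ i := fun i hi he => by
    have := h.inj (2 * k + 1) (by omega) i (by omega) (by rw [he, hfix i hi])
    omega
  have i2 : ∀ i ≤ 2 * k, α (2 * k + 2) ≠ i := fun i hi he => by
    have := h.inj (2 * k + 2) (by omega) i (by omega) (by rw [he, hfix i hi])
    omega
  have j1 : 2 * k < α (2 * k + 1) := by
    by_contra hc
    exact i1 _ (by omega) rfl
  have j2 : 2 * k < α (2 * k + 2) := by
    by_contra hc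
    exact i2 _ (by omega) rfl
  rw [hfix (2 * k) le_rfl] at a1 a2
  unfold StripAdj at a1 a2
  omega

theorem fixes_initial (h : IsStripEmbedding (2 * n) α) (h0 : α 0 = 0) {k : ℕ} (hk : k < n) :
    ∀ i ≤ 2 * k, α i = i := by
  induction k with
  | zero => intro i hi; obtain rfl : i = 0 := by omega
            exact h0
  | succ k ih =>
    have hfix := ih (by omega)
    have key : α (2 * k + 1) = 2 * k + 1 ∧ α (2 * k + 2) = 2 * k + 2 := by
      rcases h.maps_next_pair (by omega) hfix with h1 | ⟨-, h2⟩
      · exact h1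
      -- After an exchange, the two further neighbours of `2 * k + 2` would need distinct images
      -- adjacent to `2 * k + 1`; this vertex has only two neighbours, and one of them, `2 * k`, is
      -- already taken.
      exfalso
      have a1 := h.adj (2 * k + 2) (by omega) (2 * k + 3) (by omega) (by unfold StripAdj; omega)
      have a2 := h.adj (2 * k + 2) (by omega) (2 * k + 4) (by omega) (by unfold StripAdj; omega)
      have e0 := hfix (2 * k) le_rfl
      have i0 := h.inj (2 * k + 3) (by omega) (2 * k + 4) (by omega)
      have i1 := h.inj (2 * k + 3) (by omega) (2 * k) (by omega)
      have i2 := h.inj (2 * k + 4) (by omega) (2 * k) (by omega)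
      rw [h2] at a1 a2
      unfold StripAdj at a1 a2
      omega
    intro i hi
    rcases Nat.lt_or_ge (2 * k) i with hi' | hi'
    · rcases (by omega : i = 2 * k + 1 ∨ i = 2 * k + 2) with rfl | rfl
      · exact key.1
      · exact key.2
    · exact hfix i hi'

theorem last_eq_or (h : IsStripEmbedding (2 * n) α) (hn : 0 < n) (h0 : α 0 = 0) :
    α (2 * n) = 2 * n ∨ α (2 * n) = 2 * n - 1 := by
  have := h.maps_next_pair (k := n - 1) (by omega) (h.fixes_initial h0 (by omega))
  rw [show 2 * (n - 1) + 2 = 2 * n by omega] at this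
  omega

theorem eq_self (h : IsStripEmbedding (2 * n) α) (hn : 0 < n) (h0 : α 0 = 0)
    (hL : α (2 * n) = 2 * n) : ∀ i ≤ 2 * n, α i = i := by
  intro i hi
  have hfix := h.fixes_initial h0 (k := n - 1) (by omega)
  have := h.maps_next_pair (k := n - 1) (by omega) hfix
  rw [show 2 * (n - 1) + 2 = 2 * n by omega] at this
  rcases Nat.lt_or_ge (2 * (n - 1)) i with hi' | hi'
  · rcases (by omega : i = 2 * (n - 1) + 1 ∨ i = 2 * n) with rfl | rfl
    · omega
    · exact hL
  · exact hfix i hi'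

/-- An end vertex of the strip is not mapped to a vertex of degree four. -/
theorem not_inner {β : ℕ → ℕ} (hβ : IsStripEmbedding (2 * n) β)
    (hβα : ∀ i ≤ 2 * n, β (α i) = i) {i k : ℕ} (hi : i ≤ 1) (hk : 0 < k) (hkn : k < n) :
    α i ≠ 2 * k := by
  intro he
  have hb : β (2 * k) = i := by rw [← he]; exact hβα i (by omega)
  -- Three neighbours of `2 * k` would have distinct images adjacent to `i`, but 0 and 1 have degree
  -- two.
  have a1 := hβ.adj (2 * k) (by omega) (2 * k - 1) (by omega) (by unfold StripAdj; omega)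
  have a2 := hβ.adj (2 * k) (by omega) (2 * k + 1) (by omega) (by unfold StripAdj; omega)
  have a3 := hβ.adj (2 * k) (by omega) (2 * k + 2) (by omega) (by unfold StripAdj; omega)
  have i1 := hβ.inj (2 * k - 1) (by omega) (2 * k + 1) (by omega)
  have i2 := hβ.inj (2 * k - 1) (by omega) (2 * k + 2) (by omega)
  have i3 := hβ.inj (2 * k + 1) (by omega) (2 * k + 2) (by omega)
  rw [hb] at a1 a2 a3
  unfold StripAdj at a1 a2 a3
  omega

theorem zero_mem_ends {β : ℕ → ℕ} (h : IsStripEmbedding (2 * n) α)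
    (hβ : IsStripEmbedding (2 * n) β) (hn : 0 < n) (hβα : ∀ i ≤ 2 * n, β (α i) = i) :
    α 0 = 0 ∨ α 0 = 1 ∨ α 0 = 2 * n - 1 ∨ α 0 = 2 * n := by
  have a := h.adj 0 (by omega) 1 (by omega) (by unfold StripAdj; omega)
  have l0 := h.le 0 (by omega)
  have l1 := h.le 1 (by omega)
  have n0 : ∀ k, 0 < k → k < n → α 0 ≠ 2 * k := fun k => hβ.not_inner hβα (by omega)
  have n1 : ∀ k, 0 < k → k < n → α 1 ≠ 2 * k := fun k => hβ.not_inner hβα (by omega)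
  -- The images of 0 and 1 are adjacent and neither is an inner even vertex; only the two end pairs
  -- qualify. Halving supplies the one instance of `k` that matters.
  have m0 := n0 (α 0 / 2)
  have m1 := n1 (α 1 / 2)
  unfold StripAdj at a
  omega

end IsStripEmbedding

/-! ### Sums of generators and adjacency -/

/-- The generators of the augmented cube in the order of the strip of triangles they form:
`onesFrom 0, e₁, onesFrom 1, e₂, …`. -/
def stripGen (n m : ℕ) : Z2 n :=
  fun j => if m / 2 ≤ (j : ℕ) ∧ (m % 2 = 0 ∨ (j : ℕ) = m / 2) then 1 else 0

theorem Z2.add_self {n : ℕ} (x : Z2 n) : x + x = 0 := by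
  funext j; exact CharTwo.add_self_eq_zero _

theorem Z2.add_eq_iff {n : ℕ} (x y z : Z2 n) : x + y = z ↔ x = z + y := by
  constructor
  · rintro rfl; rw [add_assoc, Z2.add_self, add_zero]
  · rintro rfl; rw [add_assoc, Z2.add_self, add_zero]

theorem Z2.add_add_cancel {n : ℕ} (x y : Z2 n) : x + y + y = x := by
  rw [add_assoc, Z2.add_self, add_zero]

theorem onesFrom_eq_stripGen {n : ℕ} (k : Fin n) : onesFrom k = stripGen n (2 * k) := by
  funext j
  simp only [onesFrom, stripGen, Fin.le_def]
  congr 1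
  simp

theorem single_eq_stripGen {n : ℕ} (k : Fin n) :
    (Pi.single k 1 : Z2 n) = stripGen n (2 * k + 1) := by
  funext j
  simp only [Pi.single_apply, stripGen, Fin.ext_iff]
  congr 1
  simp only [eq_iff_iff]
  omega

/-- The last unit vector has two indices, so the strip stops at `2 * (n - 1)` and has `2 * n - 1`
vertices. -/
theorem stripGen_last {n : ℕ} (hn : 0 < n) :
    stripGen n (2 * (n - 1) + 1) = stripGen n (2 * (n - 1)) := by
  funext j
  simp only [stripGen]
  congr 1
  simp only [eq_iff_iff]
  omega

theorem mem_augGens_iff {n : ℕ} (hn : 0 < n) (v : Z2 n) :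
    v ∈ augGens n ↔ ∃ m ≤ 2 * (n - 1), v = stripGen n m := by
  constructor
  · rintro (⟨i, rfl⟩ | ⟨k, hk, rfl⟩)
    · rw [single_eq_stripGen]
      rcases Nat.lt_or_ge i.val (n - 1) with h | h
      · exact ⟨2 * i + 1, by omega, rfl⟩
      · refine ⟨2 * (n - 1), le_rfl, ?_⟩
        rw [show (i : ℕ) = n - 1 by omega, stripGen_last hn]
    · exact ⟨2 * k, by omega, onesFrom_eq_stripGen k⟩
  · rintro ⟨m, hm, rfl⟩
    rcases Nat.even_or_odd' m with ⟨k, rfl | rfl⟩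
    · rcases Nat.lt_or_ge (k + 1) n with h | h
      · exact Or.inr ⟨⟨k, by omega⟩, h, (onesFrom_eq_stripGen ⟨k, by omega⟩).symm⟩
      · refine Or.inl ⟨⟨n - 1, by omega⟩, ?_⟩
        rw [single_eq_stripGen, stripGen_last hn, show k = n - 1 by omega]
    · exact Or.inl ⟨⟨k, by omega⟩, (single_eq_stripGen ⟨k, by omega⟩).symm⟩

theorem stripGen_mem {n m : ℕ} (hn : 0 < n) (hm : m ≤ 2 * (n - 1)) :
    stripGen n m ∈ augGens n := (mem_augGens_iff hn _).2 ⟨m, hm, rfl⟩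

theorem stripGen_injOn {n i j : ℕ} (hi : i ≤ 2 * (n - 1)) (hj : j ≤ 2 * (n - 1)) (hn : 0 < n)
    (h : stripGen n i = stripGen n j) : i = j := by
  have key : ∀ t < n, (i / 2 ≤ t ∧ (i % 2 = 0 ∨ t = i / 2)) ↔
      (j / 2 ≤ t ∧ (j % 2 = 0 ∨ t = j / 2)) := by
    intro t ht
    have := congrFun h ⟨t, ht⟩
    simp only [stripGen] at this
    split_ifs at this with h1 h2 h2
    · exact iff_of_true h1 h2
    · exact absurd this one_ne_zero
    · exact absurd this zero_ne_one
    · exact iff_of_false h1 h2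
  have k1 := key (i / 2) (by omega)
  have k2 := key (j / 2) (by omega)
  have k3 := key (n - 1) (by omega)
  omega

theorem stripGen_ne_zero {n i : ℕ} (hi : i ≤ 2 * (n - 1)) (hn : 0 < n) : stripGen n i ≠ 0 := by
  intro h
  have := congrFun h ⟨i / 2, by omega⟩
  simp [stripGen] at this

theorem stripGen_triangle (n k : ℕ) :
    stripGen n (2 * k) + stripGen n (2 * k + 2) = stripGen n (2 * k + 1) := by
  funext j
  simp only [stripGen, Pi.add_apply]
  split_ifs <;> first | omega | simp | exact CharTwo.add_self_eq_zero _

theorem ZMod.two_ite_add_ite {p q r : Prop} [Decidable p] [Decidable q] [Decidable r]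
    (h : (if p then 1 else 0) + (if q then 1 else 0) = (if r then 1 else 0 : ZMod 2)) :
    (p ↔ ¬ q) ↔ r := by
  by_cases hp : p <;> by_cases hq : q <;> by_cases hr : r <;> simp_all

theorem xor_telescope {a a' b b' c c' : Prop} (h : (a ↔ ¬ b) ↔ c) (h' : (a' ↔ ¬ b') ↔ c') :
    ((a ↔ ¬ a') ↔ ¬ (b ↔ ¬ b')) ↔ (c ↔ ¬ c') := by
  rw [← h, ← h']
  by_cases a <;> by_cases a' <;> by_cases b <;> by_cases b' <;> simp_all

/-- Passing to differences of consecutive coordinates is linear and turns a block of ones into its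
jumps: `stripGen n m` becomes a vector supported on `m / 2` and `(m + 1) / 2`, as far as these are
below `n`. Sums can then be compared at very few coordinates. -/
theorem stripGen_add_eq_support {n i j k : ℕ} (h : stripGen n i + stripGen n j = stripGen n k) :
    ∀ t < n, ((t = i / 2 ∨ t = (i + 1) / 2) ↔ ¬ (t = j / 2 ∨ t = (j + 1) / 2)) ↔
      (t = k / 2 ∨ t = (k + 1) / 2) := by
  have key : ∀ t < n, ((i / 2 ≤ t ∧ (i % 2 = 0 ∨ t = i / 2)) ↔
      ¬ (j / 2 ≤ t ∧ (j % 2 = 0 ∨ t = j / 2))) ↔ (k / 2 ≤ t ∧ (k % 2 = 0 ∨ t = k / 2)) := by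
    intro t ht
    have := congrFun h ⟨t, ht⟩
    simp only [stripGen, Pi.add_apply] at this
    exact ZMod.two_ite_add_ite this
  intro t ht
  have h1 := key t ht
  rcases Nat.eq_zero_or_pos t with h0 | h0
  · clear key; omega
  · have h2 := key (t - 1) (by omega)
    have aux : ∀ m, (t = m / 2 ∨ t = (m + 1) / 2) ↔
      ((m / 2 ≤ t ∧ (m % 2 = 0 ∨ t = m / 2)) ↔
        ¬ (m / 2 ≤ t - 1 ∧ (m % 2 = 0 ∨ t - 1 = m / 2))) := by intro m; omega
    rw [aux i, aux j, aux k]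
    exact xor_telescope h1 h2

theorem stripGen_add_eq {n i j k : ℕ} (hi : i ≤ 2 * (n - 1)) (hj : j ≤ 2 * (n - 1))
    (hk : k ≤ 2 * (n - 1)) (hn : 0 < n) (h : stripGen n i + stripGen n j = stripGen n k) :
    StripAdj i j := by
  have key := stripGen_add_eq_support h
  have hij : i ≠ j := by
    rintro rfl
    have := key (k / 2) (by omega)
    tauto
  have k1 := key (i / 2) (by omega)
  have k2 := key ((i + 1) / 2) (by omega)
  have k3 := key (j / 2) (by omega)
  have k4 := key ((j + 1) / 2) (by omega)
  clear key
  unfold StripAdj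
  have e0 : ∀ a, 2 * a / 2 = a := fun a => by omega
  have e1 : ∀ a, (2 * a + 1) / 2 = a := fun a => by omega
  have e2 : ∀ a, (2 * a + 1 + 1) / 2 = a + 1 := fun a => by omega
  rcases Nat.even_or_odd' i with ⟨a, rfl | rfl⟩ <;>
  rcases Nat.even_or_odd' j with ⟨b, rfl | rfl⟩ <;>
  rcases Nat.even_or_odd' k with ⟨c, rfl | rfl⟩ <;>
  simp only [e0, e1, e2, or_self, true_or, or_true, true_iff, not_true_eq_false,
    iff_false] at k1 k2 k3 k4 <;>
  omega

theorem stripGen_add_mem_iff {n i j : ℕ} (hi : i ≤ 2 * (n - 1)) (hj : j ≤ 2 * (n - 1))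
    (hn : 0 < n) : stripGen n i + stripGen n j ∈ augGens n ↔ StripAdj i j := by
  rw [mem_augGens_iff hn]
  constructor
  · rintro ⟨k, hk, h⟩
    exact stripGen_add_eq hi hj hk hn h
  · have tri : ∀ k, k + 1 < n → stripGen n (2 * k + 1) + stripGen n (2 * k) =
        stripGen n (2 * k + 2) ∧ stripGen n (2 * k + 1) + stripGen n (2 * k + 2) =
        stripGen n (2 * k) := by
      intro k hk
      rw [← stripGen_triangle n k]
      exact ⟨by rw [add_comm, ← add_assoc, Z2.add_self, zero_add], Z2.add_add_cancel _ _⟩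
    have succ : ∀ i, i + 1 ≤ 2 * (n - 1) →
        ∃ m ≤ 2 * (n - 1), stripGen n i + stripGen n (i + 1) = stripGen n m := by
      intro i hi
      rcases Nat.even_or_odd' i with ⟨k, rfl | rfl⟩
      · exact ⟨2 * k + 2, by omega, by rw [add_comm]; exact (tri k (by omega)).1⟩
      · exact ⟨2 * k, by omega, (tri k (by omega)).2⟩
    rintro (rfl | rfl | ⟨h0, rfl | rfl⟩)
    · exact succ i hj
    · rw [add_comm]; exact succ j hi
    · obtain ⟨k, rfl⟩ := Nat.dvd_of_mod_eq_zero h0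
      exact ⟨2 * k + 1, by omega, stripGen_triangle n k⟩
    · obtain ⟨k, rfl⟩ : ∃ k, j = 2 * k := ⟨j / 2, by omega⟩
      rw [add_comm]
      exact ⟨2 * k + 1, by omega, stripGen_triangle n k⟩

theorem AQ_adj_iff {n : ℕ} (hn : 0 < n) (x y : Z2 n) : (AQ n).Adj x y ↔ x + y ∈ augGens n := by
  rw [AQ, SimpleGraph.addCayley_adj']
  constructor
  · rintro ⟨-, g, hg, rfl | rfl⟩
    · rwa [← add_assoc, Z2.add_self, zero_add]
    · rwa [add_comm y g, Z2.add_add_cancel]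
  · intro h
    refine ⟨?_, _, h, Or.inl (by rw [← add_assoc, Z2.add_self, zero_add])⟩
    rintro rfl
    obtain ⟨m, hm, h⟩ := (mem_augGens_iff hn _).1 h
    rw [Z2.add_self] at h
    exact stripGen_ne_zero hm hn h.symm

/-- Induction along the generators. -/
theorem Z2.induction_stripGen {n : ℕ} (hn : 0 < n) {P : Z2 n → Prop} (h0 : P 0)
    (hadd : ∀ x, ∀ m ≤ 2 * (n - 1), P x → P (x + stripGen n m)) (x : Z2 n) : P x := by
  have key : ∀ (t : Finset (Fin n)) (x : Z2 n), P x → P (x + ∑ i ∈ t, Pi.single i 1) := by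
    intro t
    induction t using Finset.induction_on with
    | empty => intro x hx; simpa using hx
    | insert a t ha ih =>
      intro x hx
      rw [Finset.sum_insert ha, ← add_assoc]
      apply ih
      obtain ⟨m, hm, h⟩ := (mem_augGens_iff hn _).1 (Or.inl ⟨a, rfl⟩)
      rw [h]
      exact hadd x m hm hx
  have := key (Finset.univ.filter fun i => x i = 1) 0 h0
  convert this
  funext j
  simp only [zero_add, Finset.sum_apply, Pi.single_apply, Finset.sum_ite_eq, Finset.mem_filter,
    Finset.mem_univ, true_and]
  generalize x j = c
  revert c; decide

/-! ### Rigidity of the augmented cube -/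

/-- An injective endomorphism of the augmented cube. -/
structure IsAQEmbedding {n : ℕ} (g : Z2 n → Z2 n) : Prop where
  inj : Function.Injective g
  map_adj : ∀ x y, x + y ∈ augGens n → g x + g y ∈ augGens n

namespace IsAQEmbedding

variable {n : ℕ} {g : Z2 n → Z2 n}

/-- The neighbours of a vertex form a strip of triangles, on which an embedding of the augmented
cube acts. -/
theorem exists_stripEmbedding (h : IsAQEmbedding g) (hn : 0 < n) (v : Z2 n) :
    ∃ α, IsStripEmbedding (2 * (n - 1)) α ∧
      ∀ i ≤ 2 * (n - 1), g (v + stripGen n i) = g v + stripGen n (α i) := by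
  have ex : ∀ i, ∃ m, i ≤ 2 * (n - 1) →
      m ≤ 2 * (n - 1) ∧ g (v + stripGen n i) = g v + stripGen n m := by
    intro i
    by_cases hi : i ≤ 2 * (n - 1)
    · have := h.map_adj (v + stripGen n i) v (by
        rw [add_right_comm, Z2.add_self, zero_add]; exact stripGen_mem hn hi)
      obtain ⟨m, hm, e⟩ := (mem_augGens_iff hn _).1 this
      exact ⟨m, fun _ => ⟨hm, by rw [Z2.add_eq_iff] at e; rw [e, add_comm]⟩⟩
    · exact ⟨0, fun h => absurd h hi⟩
  choose α hα using ex
  refine ⟨α, ⟨fun i hi => (hα i hi).1, fun i hi j hj e => ?_, fun i hi j hj a => ?_⟩,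
    fun i hi => (hα i hi).2⟩
  · apply stripGen_injOn hi hj hn
    apply add_left_cancel (a := v)
    apply h.inj
    rw [(hα i hi).2, (hα j hj).2, e]
  · rw [← stripGen_add_mem_iff (hα i hi).1 (hα j hj).1 hn]
    have := h.map_adj (v + stripGen n i) (v + stripGen n j) (by
      rw [add_add_add_comm, Z2.add_self, zero_add]
      exact (stripGen_add_mem_iff hi hj hn).2 a)
    rwa [(hα i hi).2, (hα j hj).2, add_add_add_comm, Z2.add_self, zero_add] at this

theorem fixes_neighbors (h : IsAQEmbedding g) (hn : 1 < n) {v : Z2 n} (hv : g v = v)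
    (h0 : g (v + stripGen n 0) = v + stripGen n 0)
    (hL : g (v + stripGen n (2 * (n - 1))) = v + stripGen n (2 * (n - 1))) :
    ∀ i ≤ 2 * (n - 1), g (v + stripGen n i) = v + stripGen n i := by
  obtain ⟨α, hα, e⟩ := h.exists_stripEmbedding (by omega) v
  have key : ∀ i ≤ 2 * (n - 1), g (v + stripGen n i) = v + stripGen n i → α i = i := by
    intro i hi hf
    rw [e i hi, hv] at hf
    exact stripGen_injOn (hα.le i hi) hi (by omega) (add_left_cancel hf)
  intro i hi
  rw [e i hi, hv, hα.eq_self (by omega) (key 0 (by omega) h0) (key _ le_rfl hL) i hi]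

/-- By `fixes_neighbors` it suffices, at each neighbour of `v`, to fix the two end directions `0`
and `2 * (n - 1)`. This is shown at `v + stripGen n 0`, then at `v + stripGen n (2 * (n - 1))`;
commuting the two summands carries it to every other neighbour. -/
theorem fixes_second_neighbors (h : IsAQEmbedding g) (hn : 4 ≤ n) {v : Z2 n}
    (hv : g v = v) (hS : ∀ i ≤ 2 * (n - 1), g (v + stripGen n i) = v + stripGen n i)
    {j : ℕ} (hj : j ≤ 2 * (n - 1)) :
    ∀ i ≤ 2 * (n - 1), g (v + stripGen n j + stripGen n i) = v + stripGen n j + stripGen n i := by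
  have back : ∀ j ≤ 2 * (n - 1), g (v + stripGen n j + stripGen n j) =
      v + stripGen n j + stripGen n j := by
    intro j _; rw [Z2.add_add_cancel, hv]
  have first : ∀ i ≤ 2 * (n - 1),
      g (v + stripGen n 0 + stripGen n i) = v + stripGen n 0 + stripGen n i := by
    apply h.fixes_neighbors (by omega) (hS 0 (by omega)) (back 0 (by omega))
    obtain ⟨α, hα, e⟩ := h.exists_stripEmbedding (by omega) (v + stripGen n 0)
    have e' := e _ le_rfl
    have α0 : α 0 = 0 := by
      have := e 0 (by omega)
      rw [back 0 (by omega), hS 0 (by omega)] at this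
      exact (stripGen_injOn (by omega) (hα.le 0 (by omega)) (by omega)
        (add_left_cancel this)).symm
    rw [hS 0 (by omega)] at e'
    rcases hα.last_eq_or (by omega) α0 with h1 | h1
    · rw [e', h1]
    -- The vertex in direction `2 * (n - 1)` is adjacent to the fixed vertex `v + stripGen n (2 * (n
    -- - 1))`. If it were moved, `stripGen n 0 + stripGen n (2 * (n - 2))` would be a generator,
    -- whereas 0 and `2 * (n - 2)` are not adjacent in the strip once `4 ≤ n`.
    · exfalso
      have adj := h.map_adj (v + stripGen n 0 + stripGen n (2 * (n - 1)))
        (v + stripGen n (2 * (n - 1))) (by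
          rw [add_right_comm v, add_comm _ (stripGen n 0), Z2.add_add_cancel]
          exact stripGen_mem (by omega) (by omega))
      have tri := stripGen_triangle n (n - 2)
      rw [show 2 * (n - 2) + 2 = 2 * (n - 1) by omega,
        show 2 * (n - 2) + 1 = 2 * (n - 1) - 1 by omega] at tri
      rw [hS _ le_rfl, e', h1, ← tri,
        show v + stripGen n 0 + (stripGen n (2 * (n - 2)) + stripGen n (2 * (n - 1))) +
          (v + stripGen n (2 * (n - 1))) = (v + v) + (stripGen n 0 + stripGen n (2 * (n - 2))) +
          (stripGen n (2 * (n - 1)) + stripGen n (2 * (n - 1))) by abel,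
        Z2.add_self, Z2.add_self, zero_add, add_zero,
        stripGen_add_mem_iff (by omega) (by omega) (by omega)] at adj
      unfold StripAdj at adj
      omega
  have last : ∀ i ≤ 2 * (n - 1), g (v + stripGen n (2 * (n - 1)) + stripGen n i) =
      v + stripGen n (2 * (n - 1)) + stripGen n i := by
    apply h.fixes_neighbors (by omega) (hS _ le_rfl) _ (back _ le_rfl)
    rw [add_right_comm]
    exact first _ le_rfl
  apply h.fixes_neighbors (by omega) (hS j hj)
  · rw [add_right_comm]; exact first j hj
  · rw [add_right_comm]; exact last j hj

/-- An embedding of the augmented cube that fixes `0`, `1⋯1` and `0⋯01` is the identity. -/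
theorem eq_self (h : IsAQEmbedding g) (hn : 4 ≤ n) (h0 : g 0 = 0)
    (hf : g (stripGen n 0) = stripGen n 0)
    (hL : g (stripGen n (2 * (n - 1))) = stripGen n (2 * (n - 1))) (x : Z2 n) : g x = x := by
  exact (Z2.induction_stripGen (by omega)
    (P := fun x => g x = x ∧ ∀ i ≤ 2 * (n - 1), g (x + stripGen n i) = x + stripGen n i)
    ⟨h0, h.fixes_neighbors (by omega) h0 (by simpa using hf) (by simpa using hL)⟩
    (fun x m hm ih => ⟨ih.2 m hm, h.fixes_second_neighbors hn ih.1 ih.2 hm⟩) x).1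

end IsAQEmbedding

/-! ### Linear symmetries of the generators -/

/-- The automorphism of `ℤ₂ⁿ` that exchanges `10⋯0` and `1⋯1` and fixes the other generators. -/
def firstSwap {n : ℕ} (hn : 1 < n) : Z2 n ≃+ Z2 n where
  toFun x := x + x ⟨0, by omega⟩ • stripGen n 2
  invFun x := x + x ⟨0, by omega⟩ • stripGen n 2
  left_inv x := by
    have : stripGen n 2 ⟨0, by omega⟩ = 0 := by simp [stripGen]
    simp [this, Z2.add_add_cancel]
  right_inv x := by
    have : stripGen n 2 ⟨0, by omega⟩ = 0 := by simp [stripGen]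
    simp [this, Z2.add_add_cancel]
  map_add' x y := by simp only [Pi.add_apply, add_smul]; abel

theorem firstSwap_apply {n : ℕ} (hn : 1 < n) (x : Z2 n) :
    firstSwap hn x = x + x ⟨0, by omega⟩ • stripGen n 2 := rfl

theorem firstSwap_zero {n : ℕ} (hn : 1 < n) : firstSwap hn (stripGen n 0) = stripGen n 1 := by
  have : stripGen n 0 ⟨0, by omega⟩ = 1 := by simp [stripGen]
  rw [firstSwap_apply, this, one_smul]
  exact stripGen_triangle n 0

theorem firstSwap_one {n : ℕ} (hn : 1 < n) : firstSwap hn (stripGen n 1) = stripGen n 0 := by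
  have : stripGen n 1 ⟨0, by omega⟩ = 1 := by simp [stripGen]
  rw [firstSwap_apply, this, one_smul, Z2.add_eq_iff]
  exact (stripGen_triangle n 0).symm

theorem firstSwap_of_two_le {n m : ℕ} (hn : 1 < n) (hm : 2 ≤ m) :
    firstSwap hn (stripGen n m) = stripGen n m := by
  have : stripGen n m ⟨0, by omega⟩ = 0 := by simp [stripGen]; omega
  rw [firstSwap_apply, this, zero_smul, add_zero]

/-- The automorphism of `ℤ₂ⁿ` that reverses the strip of generators. -/
def stripReversal {n : ℕ} (hn : 1 < n) : Z2 n ≃+ Z2 n :=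
  -- In the difference coordinates `x j - x (j - 1)`, with `x (-1) = 0`, this map reverses the order
  -- of the coordinates; summing back up to `j` gives the formula.
  let f : Z2 n → Z2 n := fun x j =>
    x ⟨n - 1, by omega⟩ + if h : (j : ℕ) + 1 < n then x ⟨n - 2 - j, by omega⟩ else 0
  have hf : ∀ x, f (f x) = x := fun x => by
    funext j
    have last : ¬ n - 1 + 1 < n := by omega
    by_cases hj : (j : ℕ) + 1 < n
    · have hj' : n - 2 - (j : ℕ) + 1 < n := by omega
      have hjj : n - 2 - (n - 2 - (j : ℕ)) = j := by omega
      simp only [f, last, hj, hj', hjj, dite_true, dite_false, add_zero]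
      rw [← add_assoc, CharTwo.add_self_eq_zero, zero_add]
    · have hj' : (⟨n - 1, by omega⟩ : Fin n) = j := Fin.ext (by simp only; omega)
      simp only [f, hj, dite_false, add_zero, hj']
  { toFun := f
    invFun := f
    left_inv := hf
    right_inv := hf
    map_add' := fun x y => by
      funext j
      simp only [f, Pi.add_apply]
      split_ifs
      · abel
      · abel }

theorem stripReversal_even {n k : ℕ} (hn : 1 < n) (hk : k < n) :
    stripReversal hn (stripGen n (2 * k)) = stripGen n (2 * (n - 1 - k)) := by
  funext j
  simp only [stripReversal, stripGen, AddEquiv.coe_mk, Equiv.coe_fn_mk]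
  split_ifs <;> first | omega | simp | exact CharTwo.add_self_eq_zero _

theorem stripReversal_stripGen {n m : ℕ} (hn : 1 < n) (hm : m ≤ 2 * (n - 1)) :
    stripReversal hn (stripGen n m) = stripGen n (2 * (n - 1) - m) := by
  rcases Nat.even_or_odd' m with ⟨k, rfl | rfl⟩
  · rw [stripReversal_even hn (by omega)]; congr 1; omega
  · rw [← stripGen_triangle, map_add, stripReversal_even hn (by omega),
      show 2 * k + 2 = 2 * (k + 1) by ring, stripReversal_even hn (by omega), add_comm,
      show 2 * (n - 1) - (2 * k + 1) = 2 * (n - 1 - (k + 1)) + 1 by omega, ← stripGen_triangle,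
      show 2 * (n - 1 - k) = 2 * (n - 1 - (k + 1)) + 2 by omega]

/-! ### The dihedral action -/

/-- The homomorphism from a dihedral group given by the images of a rotation and a reflection. -/
def DihedralGroup.liftOfRelations {m : ℕ} [NeZero m] {G : Type*} [Group G] (ρ σ : G)
    (hρ : ρ ^ m = 1) (hσ : σ * σ = 1) (hσρ : σ * ρ * σ = ρ⁻¹) : DihedralGroup m →* G :=
  have hadd : ∀ i j : ZMod m, ρ ^ (i + j).val = ρ ^ i.val * ρ ^ j.val := fun i j => by
    rw [ZMod.val_add, ← pow_eq_pow_mod _ hρ, pow_add]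
  have hsub : ∀ i j : ZMod m, ρ ^ (j - i).val = (ρ ^ i.val)⁻¹ * ρ ^ j.val := fun i j => by
    rw [eq_inv_mul_iff_mul_eq, ← hadd, add_sub_cancel]
  have hσ' : σ⁻¹ = σ := inv_eq_of_mul_eq_one_left hσ
  have hconj : ∀ k : ℕ, ρ ^ k * σ = σ * (ρ ^ k)⁻¹ := fun k => by
    have := conj_pow (a := σ) (b := ρ) (i := k)
    rw [hσ', hσρ, inv_pow] at this
    rw [this, mul_assoc, ← mul_assoc, hσ, one_mul]
  { toFun := fun d => match d with
      | .r i => ρ ^ i.val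
      | .sr i => σ * ρ ^ i.val
    map_one' := by
      change ρ ^ (0 : ZMod m).val = 1
      rw [ZMod.val_zero, pow_zero]
    map_mul' := by
      rintro (i | i) (j | j)
      · exact hadd i j
      · change σ * ρ ^ (j - i).val = ρ ^ i.val * (σ * ρ ^ j.val)
        rw [hsub, ← mul_assoc, ← mul_assoc, hconj]
      · change σ * ρ ^ (i + j).val = σ * ρ ^ i.val * ρ ^ j.val
        rw [hadd, mul_assoc]
      · change ρ ^ (j - i).val = σ * ρ ^ i.val * (σ * ρ ^ j.val)
        rw [hsub, mul_assoc σ, ← mul_assoc _ σ, hconj, mul_assoc σ, ← mul_assoc σ σ, hσ, one_mul] }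

section

open Multiplicative

variable {n : ℕ}

theorem MulAut.ext_stripGen (hn : 0 < n) {ψ χ : MulAut (Multiplicative (Z2 n))}
    (h : ∀ m ≤ 2 * (n - 1), ψ (ofAdd (stripGen n m)) = χ (ofAdd (stripGen n m))) : ψ = χ := by
  ext1 x
  refine Z2.induction_stripGen hn (P := fun x => ψ (ofAdd x) = χ (ofAdd x)) ?_ ?_ x.toAdd
  · rw [ofAdd_zero, map_one, map_one]
  · intro x m hm hx
    rw [ofAdd_add, map_mul, map_mul, hx, h m hm]

/-- `firstSwap` as an element of the automorphism group of `ℤ₂ⁿ`. -/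
def firstSwapAut (hn : 1 < n) : MulAut (Multiplicative (Z2 n)) :=
  AddEquiv.toMultiplicative (firstSwap hn)

/-- `stripReversal` as an element of the automorphism group of `ℤ₂ⁿ`. -/
def stripReversalAut (hn : 1 < n) : MulAut (Multiplicative (Z2 n)) :=
  AddEquiv.toMultiplicative (stripReversal hn)

theorem firstSwapAut_zero (hn : 1 < n) :
    firstSwapAut hn (ofAdd (stripGen n 0)) = ofAdd (stripGen n 1) :=
  congrArg ofAdd (firstSwap_zero hn)

theorem firstSwapAut_one (hn : 1 < n) :
    firstSwapAut hn (ofAdd (stripGen n 1)) = ofAdd (stripGen n 0) :=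
  congrArg ofAdd (firstSwap_one hn)

theorem firstSwapAut_of_two_le {m : ℕ} (hn : 1 < n) (hm : 2 ≤ m) :
    firstSwapAut hn (ofAdd (stripGen n m)) = ofAdd (stripGen n m) :=
  congrArg ofAdd (firstSwap_of_two_le hn hm)

theorem stripReversalAut_stripGen {m : ℕ} (hn : 1 < n) (hm : m ≤ 2 * (n - 1)) :
    stripReversalAut hn (ofAdd (stripGen n m)) = ofAdd (stripGen n (2 * (n - 1) - m)) :=
  congrArg ofAdd (stripReversal_stripGen hn hm)

theorem firstSwapAut_mul_self (hn : 1 < n) : firstSwapAut hn * firstSwapAut hn = 1 := by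
  apply MulAut.ext_stripGen (by omega)
  intro m hm
  rw [MulAut.mul_apply, MulAut.one_apply]
  rcases (by omega : m = 0 ∨ m = 1 ∨ 2 ≤ m) with rfl | rfl | h
  · rw [firstSwapAut_zero, firstSwapAut_one]
  · rw [firstSwapAut_one, firstSwapAut_zero]
  · rw [firstSwapAut_of_two_le hn h, firstSwapAut_of_two_le hn h]

theorem stripReversalAut_mul_self (hn : 1 < n) :
    stripReversalAut hn * stripReversalAut hn = 1 := by
  apply MulAut.ext_stripGen (by omega)
  intro m hm
  rw [MulAut.mul_apply, MulAut.one_apply, stripReversalAut_stripGen hn hm,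
    stripReversalAut_stripGen hn (by omega), Nat.sub_sub_self hm]

/-- The automorphism of order four that generates the rotations. -/
def rotationAut (hn : 1 < n) : MulAut (Multiplicative (Z2 n)) :=
  firstSwapAut hn * stripReversalAut hn

theorem rotationAut_zero (hn : 2 < n) : rotationAut (by omega) (ofAdd (stripGen n 0)) =
    ofAdd (stripGen n (2 * (n - 1))) := by
  rw [rotationAut, MulAut.mul_apply, stripReversalAut_stripGen _ (by omega),
    firstSwapAut_of_two_le _ (by omega), Nat.sub_zero]

theorem rotationAut_one (hn : 2 < n) : rotationAut (by omega) (ofAdd (stripGen n 1)) =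
    ofAdd (stripGen n (2 * (n - 1) - 1)) := by
  rw [rotationAut, MulAut.mul_apply, stripReversalAut_stripGen _ (by omega),
    firstSwapAut_of_two_le _ (by omega)]

theorem rotationAut_last (hn : 2 < n) :
    rotationAut (by omega) (ofAdd (stripGen n (2 * (n - 1)))) = ofAdd (stripGen n 1) := by
  rw [rotationAut, MulAut.mul_apply, stripReversalAut_stripGen _ (by omega), Nat.sub_self,
    firstSwapAut_zero]

theorem rotationAut_last_sub_one (hn : 2 < n) :
    rotationAut (by omega) (ofAdd (stripGen n (2 * (n - 1) - 1))) = ofAdd (stripGen n 0) := by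
  rw [rotationAut, MulAut.mul_apply, stripReversalAut_stripGen _ (by omega),
    Nat.sub_sub_self (by omega), firstSwapAut_one]

theorem rotationAut_inner {m : ℕ} (hn : 2 < n) (hm : m + 2 ≤ 2 * (n - 1)) :
    rotationAut (by omega) (ofAdd (stripGen n m)) = ofAdd (stripGen n (2 * (n - 1) - m)) := by
  rw [rotationAut, MulAut.mul_apply, stripReversalAut_stripGen _ (by omega),
    firstSwapAut_of_two_le _ (by omega)]

/-- The four end generators form the cycle `0 → 2 * (n - 1) → 1 → 2 * (n - 1) - 1 → 0`, while the
inner ones are merely reversed. -/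
theorem rotationAut_pow_four (hn : 2 < n) : rotationAut (n := n) (by omega) ^ 4 = 1 := by
  apply MulAut.ext_stripGen (by omega)
  intro m hm
  simp only [pow_succ, pow_zero, one_mul, MulAut.mul_apply, MulAut.one_apply]
  rcases (by omega : m = 0 ∨ m = 1 ∨ m = 2 * (n - 1) ∨ m = 2 * (n - 1) - 1 ∨
    (2 ≤ m ∧ m + 2 ≤ 2 * (n - 1))) with rfl | rfl | rfl | rfl | ⟨h, h'⟩
  · rw [rotationAut_zero hn, rotationAut_last hn, rotationAut_one hn, rotationAut_last_sub_one hn]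
  · rw [rotationAut_one hn, rotationAut_last_sub_one hn, rotationAut_zero hn, rotationAut_last hn]
  · rw [rotationAut_last hn, rotationAut_one hn, rotationAut_last_sub_one hn, rotationAut_zero hn]
  · rw [rotationAut_last_sub_one hn, rotationAut_zero hn, rotationAut_last hn, rotationAut_one hn]
  · rw [rotationAut_inner hn h', rotationAut_inner hn (by omega),
      Nat.sub_sub_self hm, rotationAut_inner hn h', rotationAut_inner hn (by omega),
      Nat.sub_sub_self hm]

/-- The action of the dihedral group of order eight on `ℤ₂ⁿ`. -/
def dihedralAction (hn : 2 < n) : DihedralGroup 4 →* MulAut (Multiplicative (Z2 n)) :=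
  DihedralGroup.liftOfRelations (rotationAut (by omega)) (stripReversalAut (by omega))
    (rotationAut_pow_four hn) (stripReversalAut_mul_self _) (by
      rw [rotationAut, mul_inv_rev, mul_assoc, mul_assoc, stripReversalAut_mul_self, mul_one,
        inv_eq_of_mul_eq_one_left (firstSwapAut_mul_self _),
        inv_eq_of_mul_eq_one_left (stripReversalAut_mul_self _)])

theorem dihedralAction_r (hn : 2 < n) (i : ZMod 4) :
    dihedralAction (n := n) hn (.r i) = rotationAut (by omega) ^ i.val := rfl

theorem dihedralAction_sr (hn : 2 < n) (i : ZMod 4) :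
    dihedralAction (n := n) hn (.sr i) =
      stripReversalAut (by omega) * rotationAut (by omega) ^ i.val := rfl

theorem rotationAut_mem (hn : 2 < n) {x : Multiplicative (Z2 n)} (hx : toAdd x ∈ augGens n) :
    toAdd (rotationAut (by omega) x) ∈ augGens n := by
  obtain ⟨m, hm, h⟩ := (mem_augGens_iff (by omega) _).1 hx
  obtain rfl : x = ofAdd (stripGen n m) := h
  rcases (by omega : m = 0 ∨ m = 1 ∨ m = 2 * (n - 1) ∨ m = 2 * (n - 1) - 1 ∨
    (2 ≤ m ∧ m + 2 ≤ 2 * (n - 1))) with rfl | rfl | rfl | rfl | ⟨h, h'⟩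
  · rw [rotationAut_zero hn]; exact stripGen_mem (by omega) (by omega)
  · rw [rotationAut_one hn]; exact stripGen_mem (by omega) (by omega)
  · rw [rotationAut_last hn]; exact stripGen_mem (by omega) (by omega)
  · rw [rotationAut_last_sub_one hn]; exact stripGen_mem (m := 0) (by omega) (by omega)
  · rw [rotationAut_inner hn h']; exact stripGen_mem (by omega) (by omega)

theorem stripReversalAut_mem (hn : 1 < n) {x : Multiplicative (Z2 n)}
    (hx : toAdd x ∈ augGens n) : toAdd (stripReversalAut hn x) ∈ augGens n := by
  obtain ⟨m, hm, h⟩ := (mem_augGens_iff (by omega) _).1 hx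
  obtain rfl : x = ofAdd (stripGen n m) := h
  rw [stripReversalAut_stripGen _ hm]
  exact stripGen_mem (by omega) (by omega)

theorem dihedralAction_mem (hn : 2 < n) (d : DihedralGroup 4) {x : Multiplicative (Z2 n)}
    (hx : toAdd x ∈ augGens n) : toAdd (dihedralAction hn d x) ∈ augGens n := by
  have pow : ∀ k : ℕ, toAdd ((rotationAut (n := n) (by omega) ^ k) x) ∈ augGens n := by
    intro k
    induction k with
    | zero => simpa using hx
    | succ k ih => rw [pow_succ', MulAut.mul_apply]; exact rotationAut_mem hn ih
  rcases d with i | i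
  · exact pow _
  · rw [dihedralAction_sr, MulAut.mul_apply]; exact stripReversalAut_mem _ (pow _)

theorem dihedralAction_mem_iff (hn : 2 < n) (d : DihedralGroup 4) (x : Multiplicative (Z2 n)) :
    toAdd (dihedralAction hn d x) ∈ augGens n ↔ toAdd x ∈ augGens n := by
  refine ⟨fun h => ?_, dihedralAction_mem hn d⟩
  have := dihedralAction_mem hn d⁻¹ h
  rwa [← MulAut.mul_apply, ← map_mul, inv_mul_cancel, map_one, MulAut.one_apply] at this

/-! ### Dihedral elements and translations as graph automorphisms -/

/-- The dihedral group of order eight acts on the augmented cube. -/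
def dihedralGraphAut (hn : 2 < n) : DihedralGroup 4 →* (AQ n ≃g AQ n) where
  toFun d :=
    { toFun := fun x => toAdd (dihedralAction hn d (ofAdd x))
      invFun := fun x => toAdd ((dihedralAction hn d)⁻¹ (ofAdd x))
      left_inv := fun x => by simp
      right_inv := fun x => by simp
      map_rel_iff' := fun {x y} => by
        change (AQ n).Adj (toAdd (dihedralAction hn d (ofAdd x)))
          (toAdd (dihedralAction hn d (ofAdd y))) ↔ _
        rw [AQ_adj_iff (by omega), AQ_adj_iff (by omega), ← toAdd_mul, ← map_mul,
          dihedralAction_mem_iff]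
        rfl }
  map_one' := by
    ext1 x
    change toAdd (dihedralAction hn 1 (ofAdd x)) = x
    simp
  map_mul' d d' := by
    ext1 x
    change toAdd (dihedralAction hn (d * d') (ofAdd x)) =
      toAdd (dihedralAction hn d (dihedralAction hn d' (ofAdd x)))
    rw [map_mul, MulAut.mul_apply]

theorem dihedralGraphAut_apply (hn : 2 < n) (d : DihedralGroup 4) (x : Z2 n) :
    dihedralGraphAut hn d x = toAdd (dihedralAction hn d (ofAdd x)) := rfl

theorem dihedralGraphAut_apply_zero (hn : 2 < n) (d : DihedralGroup 4) :
    dihedralGraphAut hn d 0 = 0 := by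
  rw [dihedralGraphAut_apply, ofAdd_zero, map_one, toAdd_one]

/-- The translations, as automorphisms of the augmented cube. -/
def translationGraphAut (hn : 0 < n) : Multiplicative (Z2 n) →* (AQ n ≃g AQ n) where
  toFun z :=
    { toEquiv := Equiv.addRight (toAdd z)
      map_rel_iff' := fun {x y} => by
        change (AQ n).Adj (x + toAdd z) (y + toAdd z) ↔ _
        rw [AQ_adj_iff hn, AQ_adj_iff hn, add_add_add_comm, Z2.add_self, add_zero] }
  map_one' := by
    ext1 x
    exact add_zero x
  map_mul' z w := by
    ext1 x
    change x + (toAdd z + toAdd w) = x + toAdd w + toAdd z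
    abel

theorem translationGraphAut_apply (hn : 0 < n) (z : Multiplicative (Z2 n)) (x : Z2 n) :
    translationGraphAut hn z x = x + toAdd z := rfl

/-- Each nontrivial element moves generator 0, except the reflection `.sr 1`, which moves generator
`2 * (n - 1)`. -/
theorem dihedralGraphAut_injective (hn : 4 ≤ n) :
    Function.Injective (dihedralGraphAut (n := n) (by omega)) := by
  rw [injective_iff_map_eq_one]
  intro d hd
  have key : ∀ i ≤ 2 * (n - 1), ∀ j ≤ 2 * (n - 1),
      dihedralAction (by omega) d (ofAdd (stripGen n i)) = ofAdd (stripGen n j) → j = i := by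
    intro i hi j hj h
    have := dihedralGraphAut_apply (n := n) (by omega) d (stripGen n i)
    rw [hd, h] at this
    exact (stripGen_injOn hi hj (by omega) this).symm
  have cases4 : ∀ i : ZMod 4, i = 0 ∨ i = 1 ∨ i = 2 ∨ i = 3 := by decide
  have v1 : (1 : ZMod 4).val = 1 := rfl
  have v2 : (2 : ZMod 4).val = 2 := rfl
  have v3 : (3 : ZMod 4).val = 3 := rfl
  have hn' : 2 < n := by omega
  rcases d with i | i
  · rcases cases4 i with rfl | rfl | rfl | rfl
    · rfl
    · have := key 0 (by omega) (2 * (n - 1)) (by omega) (by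
        rw [dihedralAction_r, v1, pow_one, rotationAut_zero hn'])
      omega
    · have := key 0 (by omega) 1 (by omega) (by
        rw [dihedralAction_r, v2, pow_two, MulAut.mul_apply, rotationAut_zero hn',
          rotationAut_last hn'])
      omega
    · have := key 0 (by omega) (2 * (n - 1) - 1) (by omega) (by
        rw [dihedralAction_r, v3, pow_succ, pow_two, MulAut.mul_apply, MulAut.mul_apply,
          rotationAut_zero hn', rotationAut_last hn', rotationAut_one hn'])
      omega
  · exfalso
    rcases cases4 i with rfl | rfl | rfl | rfl
    · have := key 0 (by omega) (2 * (n - 1)) (by omega) (by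
        rw [dihedralAction_sr, ZMod.val_zero, pow_zero, mul_one,
          stripReversalAut_stripGen _ (by omega), Nat.sub_zero])
      omega
    · have := key (2 * (n - 1)) (by omega) (2 * (n - 1) - 1) (by omega) (by
        rw [dihedralAction_sr, v1, pow_one, MulAut.mul_apply, rotationAut_last hn',
          stripReversalAut_stripGen _ (by omega)])
      omega
    · have := key 0 (by omega) (2 * (n - 1) - 1) (by omega) (by
        rw [dihedralAction_sr, v2, pow_two, MulAut.mul_apply, MulAut.mul_apply,
          rotationAut_zero hn', rotationAut_last hn', stripReversalAut_stripGen _ (by omega)])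
      omega
    · have := key 0 (by omega) 1 (by omega) (by
        rw [dihedralAction_sr, v3, pow_succ, pow_two, MulAut.mul_apply, MulAut.mul_apply,
          MulAut.mul_apply, rotationAut_zero hn', rotationAut_last hn', rotationAut_one hn',
          stripReversalAut_stripGen _ (by omega), Nat.sub_sub_self (by omega)])
      omega

theorem isAQEmbedding (hn : 0 < n) (g : AQ n ≃g AQ n) : IsAQEmbedding g :=
  ⟨g.injective, fun x y h => by
    rw [← AQ_adj_iff hn] at h ⊢
    exact g.map_rel_iff.2 h⟩

/-! ### The stabilizer of zero -/

/-- The dihedral group is transitive on the four ends of the strip of generators. -/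
theorem exists_dihedralGraphAut_apply_zero (hn : 2 < n) {m : ℕ}
    (hm : m = 0 ∨ m = 1 ∨ m = 2 * (n - 1) - 1 ∨ m = 2 * (n - 1)) :
    ∃ d, dihedralGraphAut hn d (stripGen n 0) = stripGen n m := by
  rcases hm with rfl | rfl | rfl | rfl
  · exact ⟨1, by rw [map_one]; rfl⟩
  · refine ⟨.r 1 * .r 1, ?_⟩
    rw [dihedralGraphAut_apply, map_mul, MulAut.mul_apply, dihedralAction_r,
      show (1 : ZMod 4).val = 1 from rfl, pow_one, rotationAut_zero hn, rotationAut_last hn,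
      toAdd_ofAdd]
  · refine ⟨.r 1 * (.r 1 * .r 1), ?_⟩
    rw [dihedralGraphAut_apply, map_mul, map_mul, MulAut.mul_apply, MulAut.mul_apply,
      dihedralAction_r, show (1 : ZMod 4).val = 1 from rfl, pow_one, rotationAut_zero hn,
      rotationAut_last hn, rotationAut_one hn, toAdd_ofAdd]
  · refine ⟨.r 1, ?_⟩
    rw [dihedralGraphAut_apply, dihedralAction_r,
      show (1 : ZMod 4).val = 1 from rfl, pow_one, rotationAut_zero hn, toAdd_ofAdd]

/-- The reflection that exchanges the last two generators fixes the first one. -/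
theorem dihedralGraphAut_sr_one (hn : 2 < n) :
    dihedralGraphAut hn (.sr 1) (stripGen n 0) = stripGen n 0 ∧
    dihedralGraphAut hn (.sr 1) (stripGen n (2 * (n - 1))) = stripGen n (2 * (n - 1) - 1) := by
  rw [dihedralGraphAut_apply, dihedralGraphAut_apply, dihedralAction_sr,
    show (1 : ZMod 4).val = 1 from rfl, pow_one, MulAut.mul_apply, MulAut.mul_apply,
    rotationAut_zero hn, rotationAut_last hn, stripReversalAut_stripGen _ (by omega),
    stripReversalAut_stripGen _ (by omega), Nat.sub_self]
  exact ⟨rfl, rfl⟩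

/-- Only the image of the other end is undetermined, with two candidates; rigidity yields the
identity for one and `.sr 1` for the other. -/
theorem exists_dihedralGraphAut_eq_of_apply_zero (hn : 4 ≤ n) {g : AQ n ≃g AQ n} (hg : g 0 = 0)
    (hg0 : g (stripGen n 0) = stripGen n 0) :
    ∃ d, dihedralGraphAut (by omega) d = g := by
  have hn' : 2 < n := by omega
  have rigid : ∀ h : AQ n ≃g AQ n, h 0 = 0 → h (stripGen n 0) = stripGen n 0 →
      h (stripGen n (2 * (n - 1))) = stripGen n (2 * (n - 1)) → h = 1 := by
    intro h h0 hf hL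
    ext1 x
    exact (isAQEmbedding (by omega) h).eq_self hn h0 hf hL x
  obtain ⟨α, hα, e⟩ := (isAQEmbedding (by omega) g).exists_stripEmbedding (by omega) 0
  simp only [zero_add, hg] at e
  have α0 : α 0 = 0 := stripGen_injOn (hα.le 0 (by omega)) (by omega) (by omega)
    (by rw [← e 0 (by omega), hg0])
  have eL := e _ le_rfl
  rcases hα.last_eq_or (by omega) α0 with h | h
  · exact ⟨1, by rw [map_one, rigid g hg hg0 (by rw [eL, h])]⟩
  · refine ⟨.sr 1, ?_⟩
    obtain ⟨r0, rL⟩ := dihedralGraphAut_sr_one hn'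
    have inv_apply : ∀ x y, dihedralGraphAut hn' (.sr 1) x = y →
        (dihedralGraphAut hn' (.sr 1))⁻¹ y = x := by
      rintro x _ rfl
      exact (dihedralGraphAut hn' (.sr 1)).symm_apply_apply x
    have := rigid ((dihedralGraphAut hn' (.sr 1))⁻¹ * g)
      (by rw [RelIso.mul_apply, hg]; exact inv_apply _ _ (dihedralGraphAut_apply_zero _ _))
      (by rw [RelIso.mul_apply, hg0]; exact inv_apply _ _ r0)
      (by rw [RelIso.mul_apply, eL, h]; exact inv_apply _ _ rL)
    exact inv_mul_eq_one.1 this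

theorem exists_dihedralGraphAut_eq (hn : 4 ≤ n) {g : AQ n ≃g AQ n} (hg : g 0 = 0) :
    ∃ d, dihedralGraphAut (by omega) d = g := by
  have hn' : 2 < n := by omega
  have hg' : g⁻¹ 0 = 0 := by
    conv_lhs => rw [← hg]
    exact g.symm_apply_apply 0
  obtain ⟨α, hα, e⟩ := (isAQEmbedding (by omega) g).exists_stripEmbedding (by omega) 0
  -- The strip map of the inverse is needed because `zero_mem_ends` compares degrees backwards along
  -- it.
  obtain ⟨β, hβ, e'⟩ := (isAQEmbedding (by omega) g⁻¹).exists_stripEmbedding (by omega) 0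
  simp only [zero_add, hg, hg'] at e e'
  have hβα : ∀ i ≤ 2 * (n - 1), β (α i) = i := by
    intro i hi
    apply stripGen_injOn (hβ.le _ (hα.le i hi)) hi (by omega)
    rw [← e' _ (hα.le i hi), ← e i hi]
    exact g.symm_apply_apply _
  obtain ⟨d, hd⟩ := exists_dihedralGraphAut_apply_zero hn'
    (hα.zero_mem_ends hβ (by omega) hβα)
  have inv_apply : ∀ x y, dihedralGraphAut hn' d x = y → (dihedralGraphAut hn' d)⁻¹ y = x := by
    rintro x _ rfl
    exact (dihedralGraphAut hn' d).symm_apply_apply x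
  obtain ⟨d', hd'⟩ := exists_dihedralGraphAut_eq_of_apply_zero hn
    (g := (dihedralGraphAut hn' d)⁻¹ * g)
    (by rw [RelIso.mul_apply, hg]; exact inv_apply _ _ (dihedralGraphAut_apply_zero _ _))
    (by rw [RelIso.mul_apply, e 0 (by omega)]; exact inv_apply _ _ hd)
  exact ⟨d * d', by rw [map_mul, hd', mul_inv_cancel_left]⟩

theorem dihedralGraphAut_range (hn : 4 ≤ n) :
    (dihedralGraphAut (n := n) (by omega)).range =
      MulAction.stabilizer (AQ n ≃g AQ n) (0 : Z2 n) := by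
  ext g
  rw [MulAction.mem_stabilizer_iff, RelIso.smul_def]
  constructor
  · rintro ⟨d, rfl⟩
    exact dihedralGraphAut_apply_zero _ d
  · exact exists_dihedralGraphAut_eq hn

/-! ### Semidirect product and normality -/

/-- Every automorphism is a translation after an element of the dihedral group. -/
theorem exists_translation_mul_dihedral (hn : 4 ≤ n) (g : AQ n ≃g AQ n) :
    ∃ z d, translationGraphAut (by omega) z * dihedralGraphAut (by omega) d = g := by
  have hn' : 0 < n := by omega
  obtain ⟨d, hd⟩ := exists_dihedralGraphAut_eq hn
    -- Translation by `g 0` is its own inverse, so it brings `g 0` back to 0.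
    (g := translationGraphAut hn' (ofAdd (g 0)) * g) (by
      rw [RelIso.mul_apply, translationGraphAut_apply, toAdd_ofAdd, Z2.add_self])
  refine ⟨ofAdd (g 0), d, ?_⟩
  rw [hd, ← mul_assoc, ← map_mul, ← ofAdd_add, Z2.add_self, ofAdd_zero, map_one, one_mul]

/-- The semidirect product maps onto the automorphism group. -/
def semidirectHom (hn : 2 < n) :
    Multiplicative (Z2 n) ⋊[dihedralAction hn] DihedralGroup 4 →* (AQ n ≃g AQ n) :=
  SemidirectProduct.lift (translationGraphAut (by omega)) (dihedralGraphAut hn) fun d => by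
    refine MonoidHom.ext fun z => ?_
    have hn0 : 0 < n := by omega
    change translationGraphAut hn0 (dihedralAction hn d z) =
      dihedralGraphAut hn d * translationGraphAut hn0 z * (dihedralGraphAut hn d)⁻¹
    -- The compatibility condition reduces to additivity of the dihedral action.
    rw [eq_mul_inv_iff_mul_eq]
    ext1 x
    change toAdd (dihedralAction hn d (ofAdd x)) + toAdd (dihedralAction hn d z) =
      toAdd (dihedralAction hn d (ofAdd x * z))
    rw [map_mul, toAdd_mul]

theorem semidirectHom_comp_inr (hn : 2 < n) :
    (semidirectHom hn).comp SemidirectProduct.inr = dihedralGraphAut hn := by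
  rw [semidirectHom, SemidirectProduct.lift_comp_inr]

theorem semidirectHom_bijective (hn : 4 ≤ n) :
    Function.Bijective (semidirectHom (n := n) (by omega)) := by
  have hn' : 2 < n := by omega
  constructor
  · rw [injective_iff_map_eq_one]
    rintro ⟨z, d⟩ h
    change translationGraphAut _ z * dihedralGraphAut hn' d = 1 at h
    -- The dihedral factor fixes 0, so the value at 0 is the translation vector.
    have hz := congrArg (fun g : AQ n ≃g AQ n => g 0) h
    simp only [RelIso.mul_apply, dihedralGraphAut_apply_zero, translationGraphAut_apply,
      zero_add, RelIso.one_apply] at hz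
    obtain rfl : z = 1 := hz
    rw [map_one, one_mul] at h
    obtain rfl := (injective_iff_map_eq_one _).1 (dihedralGraphAut_injective hn) d h
    rfl
  · intro g
    obtain ⟨z, d, h⟩ := exists_translation_mul_dihedral hn g
    exact ⟨⟨z, d⟩, h⟩

theorem isNormalCayley_augGens (hn : 4 ≤ n) : IsNormalCayley (augGens n) := by
  have hn' : 2 < n := by omega
  ext σ
  rw [Set.mem_mul]
  constructor
  · rintro ⟨g, rfl⟩
    obtain ⟨z, d, h⟩ := exists_translation_mul_dihedral hn g
    refine ⟨(translationGraphAut (by omega) z).toEquiv, ⟨toAdd z, fun x => rfl⟩,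
      (dihedralGraphAut hn' d).toEquiv,
      ⟨AddEquiv.toMultiplicative.symm (dihedralAction hn' d), ?_, fun x => rfl⟩, ?_⟩
    · ext x
      constructor
      · rintro ⟨y, hy, rfl⟩
        exact dihedralAction_mem hn' d (x := ofAdd y) hy
      · intro hx
        refine ⟨toAdd ((dihedralAction hn' d)⁻¹ (ofAdd x)), ?_, ?_⟩
        · rw [← map_inv]
          exact dihedralAction_mem hn' d⁻¹ (x := ofAdd x) hx
        · exact congrArg toAdd ((dihedralAction hn' d).apply_symm_apply (ofAdd x))
    · rw [← h]; rfl
  · rintro ⟨τ, ⟨z, hz⟩, ψ, ⟨φ, hφ, hψ⟩, rfl⟩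
    refine ⟨⟨τ * ψ, fun {x y} => ?_⟩, rfl⟩
    change (AQ n).Adj (τ (ψ x)) (τ (ψ y)) ↔ (AQ n).Adj x y
    rw [AQ_adj_iff (by omega), AQ_adj_iff (by omega), hz, hz, hψ, hψ, add_add_add_comm,
      Z2.add_self, add_zero, ← map_add]
    conv_lhs => rw [← hφ]
    exact φ.injective.mem_set_image

end

theorem mainTheorem1 (n : ℕ) (hn : 4 ≤ n) :
    Nonempty (MulAction.stabilizer (AQ n ≃g AQ n) (0 : Z2 n) ≃* DihedralGroup 4) ∧
    IsNormalCayley (augGens n) ∧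
    ∃ (φ : DihedralGroup 4 →* MulAut (Multiplicative (Z2 n)))
      (Ψ : Multiplicative (Z2 n) ⋊[φ] DihedralGroup 4 ≃* (AQ n ≃g AQ n)),
      (∀ z x : Z2 n, Ψ (SemidirectProduct.inl (Multiplicative.ofAdd z)) x = x + z) ∧
      (Ψ.toMonoidHom.comp SemidirectProduct.inr).range =
        MulAction.stabilizer (AQ n ≃g AQ n) (0 : Z2 n) := by
  refine ⟨⟨(MulEquiv.subgroupCongr (dihedralGraphAut_range hn).symm).trans
    (MonoidHom.ofInjective (dihedralGraphAut_injective hn)).symm⟩, isNormalCayley_augGens hn,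
    dihedralAction _, MulEquiv.ofBijective _ (semidirectHom_bijective hn), ?_, ?_⟩
  · intro z x
    rw [MulEquiv.ofBijective_apply, semidirectHom, SemidirectProduct.lift_inl]
    rfl
  · rw [← dihedralGraphAut_range hn]
    exact congrArg MonoidHom.range (semidirectHom_comp_inr (by omega))
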